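/- Urn Solitaire is played with an urn that contains $m$ green and $n$ red balls. In each round, balls are drawn uniformly at random without replacement until a ball appears whose colour differs from that of the first ball of the round; that last ball is returned to the urn (the others are discarded), and the round ends. Rounds are played until the urn holds balls of at most one colour. Let $E(m,n)$ be the expected number of rounds. Then $E(m,n)$ is finite for all integers $m,n\ge 0$; it satisfies $E(m,0)=E(0,n)=0$ and, for $m,n\ge 1$, $$E(m,n)=1+\sum_{k=1}^{m}\frac{\binom mk}{\binom{m+n}k}\cdot\frac{n}{m+n-k}\,E(m-k,n)+\sum_{k=1}^{n}\frac{\binom nk}{\binom{m+n}k}\cdot\frac{m}{m+n-k}\,E(m,n-k).$$ Moreover, for all integers $m\ge 1$ and $n\ge 0$, $$\begin{aligned} &2(m+2)(m+1)(2mn+2m+7n+9)(m+3)\,E(m,n)\\ &-(m+3)(m+2)\,(14m^2n+6mn^2+14m^2+83mn+21n^2+91m+123n+128)\,E(m+1,n)\\ &+(m+3)\,(18m^3n+16m^2n^2+2mn^3+18m^3+167m^2n+94mn^2+7n^3+169m^2+521mn\\ &\qquad+132n^2+511m+537n+508)\,E(m+2,n)\\ &+(-10m^4n-14m^3n^2-4m^2n^3-10m^4-135m^3n-129m^2n^2-24mn^3-131m^3-684m^2n\\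 &\qquad-393mn^2-34n^3-639m^2-1535mn-396n^2-1380m-1286n-1116)\,E(m+3,n)\\ &+(m+3)(2mn+2m+5n+7)(m+n+4)(m+n+3)\,E(m+4,n)=0, \end{aligned}$$ and, for all integers $m\ge 0$ and $n\ge 1$, the recurrence obtained from this one by exchanging the roles of $m$ and $n$ (with $E(m,n+j)$, $0\le j\le 4$, in place of $E(m+j,n)$) holds as well. -/

import Mathlib

noncomputable section

namespace UrnSolitaire

/-- The rest of a round. The balls drawn so far in the round all have the same colour, and the urn
now holds `a` balls of that colour and `b` of the other. Balls are drawn uniformly at random,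
without replacement, until one of the other colour appears; that ball is put back. The value is the
law of the number of balls of the round's colour that remain (the number `b` of balls of the other
colour does not change). It is used with `b ≥ 1` only. -/
def restOfRound (b : ℕ) : (a : ℕ) → PMF (Fin (a + 1))
  | 0 => PMF.pure 0
  | a + 1 =>
    (PMF.uniformOfFintype (Fin (a + 1) ⊕ Fin b)).bind fun
      | Sum.inl _ => (restOfRound b a).map Fin.castSucc
      | Sum.inr _ => PMF.pure (Fin.last (a + 1))

/-- The law of the number of rounds of Urn Solitaire from an urn with `m` green and `n` red balls,
played until at most one colour is left. Each round starts with a ball drawn uniformly at random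
from the urn, which is not put back and which fixes the colour of the round. -/
def rounds : ℕ → ℕ → PMF ℕ
  | 0, _ => PMF.pure 0
  | _ + 1, 0 => PMF.pure 0
  | m + 1, n + 1 =>
    (PMF.uniformOfFintype (Fin (m + 1) ⊕ Fin (n + 1))).bind fun
      | Sum.inl _ =>
        (restOfRound (n + 1) m).bind fun a => (rounds a.val (n + 1)).map fun t => t + 1
      | Sum.inr _ =>
        (restOfRound (m + 1) n).bind fun b => (rounds (m + 1) b.val).map fun t => t + 1
termination_by m n => m + n

/-- The expected number of rounds from an urn with `m` green and `n` red balls. -/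
def E (m n : ℕ) : ℝ := ∫ t : ℕ, (t : ℝ) ∂(rounds m n).toMeasure

end UrnSolitaire

end

open scoped ENNReal

namespace UrnSolitaire

/-! Write `A` for `arrangements` and `S` for `scaledE`, so that `S m n = A m n / (m + n) * E m n`.
In the first-round recursion for `S` each sum runs along a row or a column, with a factor that
depends only on the fixed coordinate. Differencing once in each direction therefore removes both
sums and leaves the four-point equation `scaledE_succ_succ`.

This equation still moves in both variables. Its antidiagonal differences `S m (n+1) - S (m+1) n`,
however, satisfy a closed recurrence, which `scaledE_sub` solves explicitly by `gap` with harmonic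
numbers. Trading every `n+2` for `n+1` by this formula gives `E_second_order`, in `m` alone.

Its right-hand side is `r * (H_(m+1) - H_(n+1)) + s` with `r`, `s` rational in `m`, `n`, and
shifting `m` preserves this shape. Two shifts of the equation suffice to eliminate it, which raises
the order from two to four (`E_fourth_order`). The recurrence in `n` follows by the symmetry
`E_comm`. -/

/-! ### Expectations in `[0, ∞]` and the law of one round -/

/-- The expectation of `f` under `p`, in `[0, ∞]`. -/
noncomputable def mean {α : Type*} (p : PMF α) (f : α → ℝ≥0∞) : ℝ≥0∞ := ∑' a, p a * f a

theorem mean_pure {α : Type*} (a : α) (f : α → ℝ≥0∞) : mean (PMF.pure a) f = f a := by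
  classical
  unfold mean
  rw [tsum_eq_single a]
  · simp
  · intro b hb
    simp [PMF.pure_apply, hb]

theorem mean_bind {α β : Type*} (p : PMF α) (q : α → PMF β) (f : β → ℝ≥0∞) :
    mean (p.bind q) f = mean p fun a => mean (q a) f := by
  unfold mean
  simp_rw [PMF.bind_apply, ← ENNReal.tsum_mul_right, ← ENNReal.tsum_mul_left]
  rw [ENNReal.tsum_comm]
  simp_rw [mul_assoc]

theorem mean_map {α β : Type*} (p : PMF α) (g : α → β) (f : β → ℝ≥0∞) :
    mean (p.map g) f = mean p (f ∘ g) := by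
  rw [PMF.map, mean_bind]
  simp only [Function.comp_apply, mean_pure]
  rfl

theorem mean_add_one {α : Type*} (p : PMF α) (f : α → ℝ≥0∞) :
    mean p (fun a => f a + 1) = mean p f + 1 := by
  unfold mean
  simp_rw [mul_add, mul_one]
  rw [ENNReal.tsum_add, p.tsum_coe]

theorem mul_mean_uniform_sum (a b : ℕ) (h : a + b ≠ 0) [Nonempty (Fin a ⊕ Fin b)] (u v : ℝ≥0∞)
    (g : Fin a ⊕ Fin b → ℝ≥0∞) (hl : ∀ i, g (Sum.inl i) = u) (hr : ∀ i, g (Sum.inr i) = v) :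
    ((a + b : ℕ) : ℝ≥0∞) * mean (PMF.uniformOfFintype (Fin a ⊕ Fin b)) g = a * u + b * v := by
  have hc : ((a + b : ℕ) : ℝ≥0∞) ≠ 0 := by exact_mod_cast h
  unfold mean
  rw [tsum_fintype, Fintype.sum_sum_type]
  simp only [hl, hr, PMF.uniformOfFintype_apply, Fintype.card_sum, Fintype.card_fin,
    Finset.sum_const, Finset.card_univ, nsmul_eq_mul]
  rw [mul_add]
  congr 1
  · rw [mul_left_comm _ (a : ℝ≥0∞), ← mul_assoc _ _ u,
      ENNReal.mul_inv_cancel hc (ENNReal.natCast_ne_top _), one_mul]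
  · rw [mul_left_comm _ (b : ℝ≥0∞), ← mul_assoc _ _ v,
      ENNReal.mul_inv_cancel hc (ENNReal.natCast_ne_top _), one_mul]

theorem natCast_mul_left_cancel {k : ℕ} (hk : k ≠ 0) {x y : ℝ≥0∞}
    (h : (k : ℝ≥0∞) * x = k * y) : x = y :=
  (ENNReal.mul_right_inj (by exact_mod_cast hk) (ENNReal.natCast_ne_top _)).1 h

theorem mean_restOfRound_succ (b a : ℕ) (f : ℕ → ℝ≥0∞) :
    ((a + 1 + b : ℕ) : ℝ≥0∞) * mean (restOfRound b (a + 1)) (fun i => f i) =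
      (a + 1 : ℕ) * mean (restOfRound b a) (fun i => f i) + b * f (a + 1) := by
  rw [restOfRound, mean_bind]
  refine mul_mean_uniform_sum (a + 1) b (by omega) _ _ _ (fun i => ?_) (fun i => ?_)
  · simp only [mean_map]
    rfl
  · simp [mean_pure]

/-- The law of the number of balls left by the rest of a round, cleared of denominators. -/
theorem choose_mul_mean_restOfRound (n a : ℕ) (f : ℕ → ℝ≥0∞) :
    ((a + (n + 1)).choose a : ℝ≥0∞) * mean (restOfRound (n + 1) a) (fun i => f i) =
      ∑ j ∈ Finset.range (a + 1), ((j + n).choose j : ℝ≥0∞) * f j := by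
  induction a with
  | zero => simp [restOfRound, mean_pure]
  | succ a ih =>
    rw [Finset.sum_range_succ, ← ih]
    -- The factor `a + 1` brings out `a + n + 2`, the number of balls in the urn, so that the
    -- one-draw identity applies.
    apply natCast_mul_left_cancel (Nat.succ_ne_zero a)
    have h1 : (a + 1) * (a + 1 + (n + 1)).choose (a + 1) =
        (a + (n + 1)).choose a * (a + 1 + (n + 1)) := by
      have := Nat.add_one_mul_choose_eq (a + (n + 1)) a
      rw [show a + 1 + (n + 1) = a + (n + 1) + 1 by ring]
      linarith
    have h2 : (a + 1) * (a + 1 + n).choose (a + 1) = (a + (n + 1)).choose a * (n + 1) := by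
      have := Nat.choose_succ_right_eq (a + (n + 1)) a
      rw [show a + 1 + n = a + (n + 1) by ring]
      rw [show a + (n + 1) - a = n + 1 by omega] at this
      linarith
    have h1' : ((a + 1 : ℕ) : ℝ≥0∞) * ((a + 1 + (n + 1)).choose (a + 1) : ℕ) =
        ((a + (n + 1)).choose a : ℕ) * ((a + 1 + (n + 1) : ℕ) : ℝ≥0∞) := by exact_mod_cast h1
    have h2' : ((a + 1 : ℕ) : ℝ≥0∞) * ((a + 1 + n).choose (a + 1) : ℕ) =
        ((a + (n + 1)).choose a : ℕ) * ((n + 1 : ℕ) : ℝ≥0∞) := by exact_mod_cast h2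
    rw [Nat.succ_eq_add_one, ← mul_assoc, h1', mul_assoc, mean_restOfRound_succ, mul_add, mul_add,
      ← mul_assoc (_ : ℝ≥0∞) _ (f (a + 1)), ← mul_assoc (_ : ℝ≥0∞) _ (f (a + 1)), h2']
    congr 1
    ring

/-! ### Finiteness and the first-round recursion -/

/-- The expected number of rounds, in `[0, ∞]`. -/
noncomputable def meanRounds (m n : ℕ) : ℝ≥0∞ := mean (rounds m n) fun t => (t : ℝ≥0∞)

theorem meanRounds_zero_left (n : ℕ) : meanRounds 0 n = 0 := by
  simp [meanRounds, rounds, mean_pure]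

theorem meanRounds_zero_right (m : ℕ) : meanRounds m 0 = 0 := by
  cases m <;> simp [meanRounds, rounds, mean_pure]

theorem mean_round {a : ℕ} (p : PMF (Fin (a + 1))) (q : ℕ → PMF ℕ) :
    mean (p.bind fun i => (q i).map fun t : ℕ => t + 1) (fun t => (t : ℝ≥0∞)) =
      mean p (fun i => mean (q i) fun t => (t : ℝ≥0∞)) + 1 := by
  rw [mean_bind, ← mean_add_one]
  congr 1
  funext i
  rw [mean_map, ← mean_add_one]
  congr 1
  funext t
  exact Nat.cast_succ t

theorem mul_meanRounds_succ_succ (m n : ℕ) :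
    ((m + 1 + (n + 1) : ℕ) : ℝ≥0∞) * meanRounds (m + 1) (n + 1) =
      (m + 1 : ℕ) * (mean (restOfRound (n + 1) m) (fun i => meanRounds i (n + 1)) + 1) +
      (n + 1 : ℕ) * (mean (restOfRound (m + 1) n) (fun i => meanRounds (m + 1) i) + 1) := by
  rw [meanRounds, rounds, mean_bind]
  refine mul_mean_uniform_sum (m + 1) (n + 1) (by omega) _ _ _ (fun i => ?_) (fun i => ?_)
  · exact mean_round (restOfRound (n + 1) m) fun a => rounds a (n + 1)
  · exact mean_round (restOfRound (m + 1) n) fun b => rounds (m + 1) b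

theorem choose_mul_meanRounds (m n : ℕ) :
    ((m + n + 2).choose (m + 1) : ℝ≥0∞) * meanRounds (m + 1) (n + 1) =
      ((m + n + 2).choose (m + 1) : ℕ) +
      ∑ j ∈ Finset.range (m + 1), ((j + n).choose j : ℝ≥0∞) * meanRounds j (n + 1) +
      ∑ j ∈ Finset.range (n + 1), ((j + m).choose j : ℝ≥0∞) * meanRounds (m + 1) j := by
  rw [← choose_mul_mean_restOfRound n m fun j => meanRounds j (n + 1),
    ← choose_mul_mean_restOfRound m n fun j => meanRounds (m + 1) j]
  apply natCast_mul_left_cancel (show m + 1 + (n + 1) ≠ 0 by omega)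
  rw [mul_left_comm, mul_meanRounds_succ_succ]
  have h1 : (m + n + 2).choose (m + 1) * (m + 1) =
      (m + 1 + (n + 1)) * (m + (n + 1)).choose m := by
    have := Nat.add_one_mul_choose_eq (m + (n + 1)) m
    rw [show m + n + 2 = m + (n + 1) + 1 by ring]
    linarith
  have h2 : (m + n + 2).choose (m + 1) * (n + 1) =
      (m + 1 + (n + 1)) * (n + (m + 1)).choose n := by
    have := Nat.add_one_mul_choose_eq (n + (m + 1)) n
    rw [show m + n + 2 = (n + 1) + (m + 1) by ring, Nat.choose_symm_add.symm,
      show (n + 1) + (m + 1) = n + (m + 1) + 1 by ring]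
    linarith
  have h1' : ((m + n + 2).choose (m + 1) : ℝ≥0∞) * ((m + 1 : ℕ) : ℝ≥0∞) =
      ((m + 1 + (n + 1) : ℕ) : ℝ≥0∞) * ((m + (n + 1)).choose m : ℕ) := by exact_mod_cast h1
  have h2' : ((m + n + 2).choose (m + 1) : ℝ≥0∞) * ((n + 1 : ℕ) : ℝ≥0∞) =
      ((m + 1 + (n + 1) : ℕ) : ℝ≥0∞) * ((n + (m + 1)).choose n : ℕ) := by exact_mod_cast h2
  -- Pascal's rule: arrangements are split by the colour of their first ball. It merges the two `+
  -- 1`s, one for each colour, into a single term.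
  have h3 : ((m + n + 2).choose (m + 1) : ℕ) =
      (m + (n + 1)).choose m + (n + (m + 1)).choose n := by
    apply Nat.eq_of_mul_eq_mul_left (show 0 < m + 1 + (n + 1) by omega)
    linarith
  rw [mul_add, ← mul_assoc, ← mul_assoc, h1', h2']
  rw [h3]
  push_cast
  ring

/-- Every round discards at least its first ball, so the recursion only calls on smaller `m + n`; an
infinite left side would equal a finite right side. -/
theorem meanRounds_ne_top (m n : ℕ) : meanRounds m n ≠ ⊤ := by
  induction h : m + n using Nat.strong_induction_on generalizing m n with
  | _ s ih =>
    subst h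
    rcases m with _ | m
    · simp [meanRounds_zero_left]
    rcases n with _ | n
    · simp [meanRounds_zero_right]
    intro htop
    have h := choose_mul_meanRounds m n
    have hpos : ((m + n + 2).choose (m + 1) : ℝ≥0∞) ≠ 0 := by
      exact_mod_cast (Nat.choose_pos (by omega)).ne'
    rw [htop, ENNReal.mul_top hpos] at h
    refine absurd h.symm ?_
    refine ENNReal.add_ne_top.2 ⟨ENNReal.add_ne_top.2 ⟨ENNReal.natCast_ne_top _, ?_⟩, ?_⟩
    · refine ENNReal.sum_ne_top.2 fun j hj => ENNReal.mul_ne_top (ENNReal.natCast_ne_top _) ?_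
      rw [Finset.mem_range] at hj
      exact ih (j + (n + 1)) (by omega) _ _ rfl
    · refine ENNReal.sum_ne_top.2 fun j hj => ENNReal.mul_ne_top (ENNReal.natCast_ne_top _) ?_
      rw [Finset.mem_range] at hj
      exact ih (m + 1 + j) (by omega) _ _ rfl

theorem lintegral_rounds (m n : ℕ) :
    ∫⁻ t : ℕ, (t : ℝ≥0∞) ∂(rounds m n).toMeasure = meanRounds m n := by
  rw [MeasureTheory.lintegral_countable', meanRounds, mean]
  refine tsum_congr fun t => ?_
  rw [PMF.toMeasure_apply_singleton _ _ (MeasurableSet.singleton t), mul_comm]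

theorem integrable_rounds (m n : ℕ) :
    MeasureTheory.Integrable (fun t : ℕ => (t : ℝ)) (rounds m n).toMeasure := by
  refine ⟨(measurable_of_countable _).aestronglyMeasurable, ?_⟩
  rw [MeasureTheory.hasFiniteIntegral_iff_ofReal (Filter.Eventually.of_forall fun t => by simp)]
  simp only [ENNReal.ofReal_natCast]
  rw [lintegral_rounds]
  exact (meanRounds_ne_top m n).lt_top

theorem E_eq_toReal (m n : ℕ) : E m n = (meanRounds m n).toReal := by
  rw [E, MeasureTheory.integral_eq_lintegral_of_nonneg_ae
    (Filter.Eventually.of_forall fun t => by simp)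
    (measurable_of_countable _).aestronglyMeasurable]
  simp only [ENNReal.ofReal_natCast]
  rw [lintegral_rounds]

theorem E_zero_left (n : ℕ) : E 0 n = 0 := by simp [E_eq_toReal, meanRounds_zero_left]

theorem E_zero_right (m : ℕ) : E m 0 = 0 := by simp [E_eq_toReal, meanRounds_zero_right]

/-- The first-round recursion, cleared of denominators. -/
theorem choose_mul_E (m n : ℕ) :
    ((m + n + 2).choose (m + 1) : ℝ) * E (m + 1) (n + 1) =
      ((m + n + 2).choose (m + 1) : ℝ) +
      ∑ j ∈ Finset.range (m + 1), ((j + n).choose j : ℝ) * E j (n + 1) +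
      ∑ j ∈ Finset.range (n + 1), ((j + m).choose j : ℝ) * E (m + 1) j := by
  have h := congrArg ENNReal.toReal (choose_mul_meanRounds m n)
  have h1 : ∀ j ∈ Finset.range (m + 1),
      ((j + n).choose j : ℝ≥0∞) * meanRounds j (n + 1) ≠ ⊤ :=
    fun j _ => ENNReal.mul_ne_top (ENNReal.natCast_ne_top _) (meanRounds_ne_top _ _)
  have h2 : ∀ j ∈ Finset.range (n + 1),
      ((j + m).choose j : ℝ≥0∞) * meanRounds (m + 1) j ≠ ⊤ :=
    fun j _ => ENNReal.mul_ne_top (ENNReal.natCast_ne_top _) (meanRounds_ne_top _ _)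
  rw [ENNReal.toReal_add (ENNReal.add_ne_top.2 ⟨ENNReal.natCast_ne_top _, ENNReal.sum_ne_top.2 h1⟩)
      (ENNReal.sum_ne_top.2 h2),
    ENNReal.toReal_add (ENNReal.natCast_ne_top _) (ENNReal.sum_ne_top.2 h1),
    ENNReal.toReal_sum h1, ENNReal.toReal_sum h2] at h
  simpa only [ENNReal.toReal_mul, ENNReal.toReal_natCast, ← E_eq_toReal] using h

theorem E_comm (m n : ℕ) : E m n = E n m := by
  induction h : m + n using Nat.strong_induction_on generalizing m n with
  | _ s ih =>
    subst h
    rcases m with _ | m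
    · rw [E_zero_left, E_zero_right]
    rcases n with _ | n
    · rw [E_zero_left, E_zero_right]
    have h1 := choose_mul_E m n
    have h2 := choose_mul_E n m
    have hc : (n + m + 2).choose (n + 1) = (m + n + 2).choose (m + 1) := by
      rw [show n + m + 2 = (n + 1) + (m + 1) by ring, show m + n + 2 = (n + 1) + (m + 1) by ring,
        Nat.choose_symm_add]
    rw [hc] at h2
    have hpos : ((m + n + 2).choose (m + 1) : ℝ) ≠ 0 := by
      exact_mod_cast (Nat.choose_pos (by omega)).ne'
    apply mul_left_cancel₀ hpos
    rw [h1, h2, add_right_comm]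
    congr 1
    · congr 1
      refine Finset.sum_congr rfl fun j hj => ?_
      rw [Finset.mem_range] at hj
      rw [ih (m + 1 + j) (by omega) (m + 1) j rfl]
    · refine Finset.sum_congr rfl fun j hj => ?_
      rw [Finset.mem_range] at hj
      rw [ih (j + (n + 1)) (by omega) j (n + 1) rfl]

/-- Once `k` balls of the first colour and then one of the other have been drawn, the remaining `j`
and `n` balls can be arranged in `(j + n).choose j` ways. -/
theorem round_weight (j k n : ℕ) :
    ((j + k).choose k : ℝ) / ((j + k + (n + 1)).choose k : ℝ)
        * (((n + 1 : ℕ) : ℝ) / (((j + k : ℕ) : ℝ) + (n + 1 : ℕ) - k))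
        * ((j + k + (n + 1)).choose (j + k) : ℝ) = ((j + n).choose j : ℝ) := by
  have h0 : ((j + k + (n + 1)).choose k : ℝ) ≠ 0 := by
    exact_mod_cast (Nat.choose_pos (by omega)).ne'
  have h1 : ((j + k + (n + 1)).choose (j + k) : ℝ) * ((j + k).choose k : ℝ) =
      ((j + k + (n + 1)).choose k : ℝ) * ((j + n + 1).choose j : ℝ) := by
    have := Nat.choose_mul (n := j + k + (n + 1)) (k := j + k) (s := k) (by omega)
    rw [show j + k + (n + 1) - k = j + n + 1 by omega, show j + k - k = j by omega] at this
    exact_mod_cast this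
  have h2 : ((j + n + 1).choose j : ℝ) * (n + 1) = (j + n + 1) * ((j + n).choose j : ℝ) := by
    have := Nat.choose_mul_succ_eq (j + n) j
    rw [show j + n + 1 - j = n + 1 by omega] at this
    have : (j + n + 1).choose j * (n + 1) = (j + n + 1) * (j + n).choose j := by linarith
    exact_mod_cast this
  have h3 : (j : ℝ) + n + 1 ≠ 0 := by positivity
  push_cast
  rw [show (j : ℝ) + k + (n + 1) - k = j + n + 1 by ring]
  field_simp
  linear_combination ((n : ℝ) + 1) * h1 + ((j + k + (n + 1)).choose k : ℝ) * h2

theorem sum_round_weight (m n : ℕ) (f : ℕ → ℝ) :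
    ((m + (n + 1)).choose m : ℝ) * ∑ k ∈ Finset.Icc 1 m, (m.choose k : ℝ) / ((m + (n + 1)).choose k : ℝ)
      * (((n + 1 : ℕ) : ℝ) / ((m : ℝ) + (n + 1 : ℕ) - k)) * f (m - k) =
    ∑ j ∈ Finset.range m, ((j + n).choose j : ℝ) * f j := by
  rw [Finset.mul_sum]
  refine Finset.sum_nbij' (fun k => m - k) (fun j => m - j) ?_ ?_ ?_ ?_ ?_
  · intro k hk
    simp only [Finset.mem_Icc, Finset.mem_range] at *
    omega
  · intro k hk
    simp only [Finset.mem_Icc, Finset.mem_range] at *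
    omega
  · intro k hk
    simp only [Finset.mem_Icc] at *
    omega
  · intro k hk
    simp only [Finset.mem_range] at *
    omega
  · intro k hk
    rw [Finset.mem_Icc] at hk
    obtain ⟨j, rfl⟩ := Nat.exists_eq_add_of_le' hk.2
    rw [Nat.add_sub_cancel, ← round_weight j k n]
    ring

/-- The first-round recursion. -/
theorem E_eq (m n : ℕ) (hm : 0 < m) (hn : 0 < n) :
    E m n = 1
        + ∑ k ∈ Finset.Icc 1 m, (m.choose k : ℝ) / ((m + n).choose k : ℝ)
            * ((n : ℝ) / ((m : ℝ) + n - k)) * E (m - k) n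
        + ∑ k ∈ Finset.Icc 1 n, (n.choose k : ℝ) / ((m + n).choose k : ℝ)
            * ((m : ℝ) / ((m : ℝ) + n - k)) * E m (n - k) := by
  obtain ⟨m, rfl⟩ := Nat.exists_eq_succ_of_ne_zero hm.ne'
  obtain ⟨n, rfl⟩ := Nat.exists_eq_succ_of_ne_zero hn.ne'
  simp only [Nat.succ_eq_add_one]
  have hpos : ((m + 1 + (n + 1)).choose (m + 1) : ℝ) ≠ 0 := by
    exact_mod_cast (Nat.choose_pos (by omega)).ne'
  have h1 := sum_round_weight (m + 1) n fun j => E j (n + 1)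
  have h2 := sum_round_weight (n + 1) m fun j => E (m + 1) j
  rw [add_comm (n + 1) (m + 1), add_comm ((n + 1 : ℕ) : ℝ), Nat.choose_symm_add.symm] at h2
  have h := choose_mul_E m n
  rw [show m + n + 2 = m + 1 + (n + 1) by ring] at h
  apply mul_left_cancel₀ hpos
  rw [h, mul_add, mul_add, h1, h2, mul_one]

/-! ### The scaled expectation and its four-point equation -/

/-- The number of arrangements of `m` green and `n` red balls, as a real number. -/
noncomputable def arrangements (m n : ℕ) : ℝ := ((m + n).choose m : ℝ)

theorem arrangements_pos (m n : ℕ) : 0 < arrangements m n := by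
  unfold arrangements
  exact_mod_cast Nat.choose_pos (by omega)

theorem arrangements_zero_left (n : ℕ) : arrangements 0 n = 1 := by simp [arrangements]

theorem arrangements_zero_right (m : ℕ) : arrangements m 0 = 1 := by simp [arrangements]

theorem arrangements_comm (m n : ℕ) : arrangements m n = arrangements n m := by
  rw [arrangements, arrangements, add_comm n m, Nat.choose_symm_add]

theorem arrangements_succ_left (m n : ℕ) :
    arrangements (m + 1) n = arrangements m n * (m + n + 1) / (m + 1) := by
  have h := Nat.add_one_mul_choose_eq (m + n) m
  rw [eq_div_iff (by positivity), arrangements, arrangements,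
    show m + 1 + n = m + n + 1 by ring]
  have : (m + n + 1).choose (m + 1) * (m + 1) = (m + n).choose m * (m + n + 1) := by linarith
  exact_mod_cast this

theorem arrangements_succ_right (m n : ℕ) :
    arrangements m (n + 1) = arrangements m n * (m + n + 1) / (n + 1) := by
  rw [arrangements_comm, arrangements_succ_left, arrangements_comm n m, add_comm (n : ℝ) m]

theorem arrangements_succ_succ (m n : ℕ) :
    arrangements (m + 1) (n + 1) = arrangements m (n + 1) + arrangements (m + 1) n := by
  have := arrangements_pos m n
  have h1 : (m : ℝ) + 1 ≠ 0 := by positivity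
  have h2 : (n : ℝ) + 1 ≠ 0 := by positivity
  rw [arrangements_succ_left m (n + 1), arrangements_succ_left, arrangements_succ_right]
  push_cast
  field_simp
  ring

/-- The expected number of rounds, scaled so that the recursion has polynomial coefficients. -/
noncomputable def scaledE (m n : ℕ) : ℝ := arrangements m n / (m + n) * E m n

theorem scaledE_zero_left (n : ℕ) : scaledE 0 n = 0 := by simp [scaledE, E_zero_left]

theorem scaledE_zero_right (m : ℕ) : scaledE m 0 = 0 := by simp [scaledE, E_zero_right]

theorem scaledE_comm (m n : ℕ) : scaledE m n = scaledE n m := by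
  rw [scaledE, scaledE, E_comm, arrangements_comm, add_comm (m : ℝ)]

/-- This is the purpose of the scaling: the binomial weight of each summand in `choose_mul_E`
becomes a factor constant along the sum. -/
theorem mul_scaledE_succ_right (m n : ℕ) :
    ((n : ℝ) + 1) * scaledE m (n + 1) = arrangements m n * E m (n + 1) := by
  have h1 : (m : ℝ) + n + 1 ≠ 0 := by positivity
  have h2 : (n : ℝ) + 1 ≠ 0 := by positivity
  rw [scaledE, arrangements_succ_right]
  push_cast
  rw [← add_assoc]
  field_simp

theorem mul_scaledE_succ_left (m n : ℕ) :
    ((m : ℝ) + 1) * scaledE (m + 1) n = arrangements m n * E (m + 1) n := by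
  rw [scaledE_comm, mul_scaledE_succ_right, E_comm, arrangements_comm]

theorem mul_scaledE_succ_succ (m n : ℕ) :
    ((m : ℝ) + n + 2) * scaledE (m + 1) (n + 1) = arrangements (m + 1) (n + 1) +
      (n + 1) * ∑ j ∈ Finset.range (m + 1), scaledE j (n + 1) +
      (m + 1) * ∑ j ∈ Finset.range (n + 1), scaledE (m + 1) j := by
  have h := choose_mul_E m n
  rw [Finset.mul_sum, Finset.mul_sum]
  simp_rw [mul_scaledE_succ_right, mul_scaledE_succ_left]
  have h1 : (m : ℝ) + n + 2 ≠ 0 := by positivity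
  rw [show m + n + 2 = m + 1 + (n + 1) by ring] at h
  rw [scaledE]
  push_cast
  rw [show (m : ℝ) + 1 + (n + 1) = m + n + 2 by ring, ← mul_assoc, mul_div_cancel₀ _ h1]
  refine h.trans ?_
  congr 1
  refine Finset.sum_congr rfl fun j _ => ?_
  rw [arrangements_comm]
  rfl

/-- The inhomogeneous term of `scaledE_succ_succ`. -/
noncomputable def source (m n : ℕ) : ℝ := arrangements m n + if m = 0 ∧ n = 0 then 1 else 0

/-- The partial difference equation with a finite stencil. -/
theorem scaledE_succ_succ (m n : ℕ) :
    ((m : ℝ) + n + 2) * scaledE (m + 1) (n + 1) =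
      (m + 2 * n + 2) * scaledE m (n + 1) + (n + 2 * m + 2) * scaledE (m + 1) n
        - 2 * (m + n) * scaledE m n + source m n := by
  have h := mul_scaledE_succ_succ m n
  rcases m with _ | m <;> rcases n with _ | n
  -- Here `A 1 1 = 2` whereas `A 0 0 = 1`, whence the extra 1 in `source`.
  · simp [scaledE_zero_left, scaledE_zero_right, source, arrangements_succ_left,
      arrangements_zero_left] at h ⊢
    linarith
  · have h' := mul_scaledE_succ_succ 0 n
    rw [Finset.sum_range_succ _ (n + 1)] at h
    simp [scaledE_zero_left, source, arrangements_succ_left,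
      arrangements_zero_left] at h h' ⊢
    linarith
  · have h' := mul_scaledE_succ_succ m 0
    rw [Finset.sum_range_succ _ (m + 1)] at h
    simp [scaledE_zero_right, source, arrangements_succ_right,
      arrangements_zero_right] at h h' ⊢
    linarith
  -- In the mixed difference each sum collapses to its last terms, and Pascal's rule reduces the
  -- four `A` terms to one.
  · have h1 := mul_scaledE_succ_succ m (n + 1)
    have h2 := mul_scaledE_succ_succ (m + 1) n
    have h3 := mul_scaledE_succ_succ m n
    rw [Finset.sum_range_succ _ (m + 1), Finset.sum_range_succ _ (n + 1)] at h
    rw [Finset.sum_range_succ _ (n + 1)] at h1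
    rw [Finset.sum_range_succ _ (m + 1)] at h2
    have h4 := arrangements_succ_succ (m + 1) (n + 1)
    simp only [source, Nat.add_eq_zero_iff, one_ne_zero, and_false, if_false, add_zero]
    push_cast at *
    linear_combination h - h1 - h2 + h3 + h4

/-! ### Closed form of the antidiagonal differences -/

/-- For `m = 0` the four-point equation says that `S 1 (n+1) - S 1 n` is `1 / (n + 2)` when `n ≥ 1`,
so the values telescope from `S 1 1 = 1`. -/
theorem scaledE_one_left (n : ℕ) : scaledE 1 (n + 1) = (harmonic (n + 2) : ℝ) - 1 / 2 := by
  induction n with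
  | zero =>
    have h := scaledE_succ_succ 0 0
    simp [scaledE_zero_left, scaledE_zero_right, source, arrangements_zero_left] at h
    simp [harmonic_succ]
    linarith
  | succ n ih =>
    have h := scaledE_succ_succ 0 (n + 1)
    simp [scaledE_zero_left, source, arrangements_zero_left] at h
    rw [ih] at h
    rw [harmonic_succ]
    push_cast
    have h1 : (n : ℝ) + 1 + 2 ≠ 0 := by positivity
    apply mul_left_cancel₀ h1
    rw [h]
    have h2 : (n : ℝ) + 2 + 1 ≠ 0 := by positivity
    field_simp
    ring

/-- The value of `scaledE m (n + 1) - scaledE (m + 1) n` for `m, n ≥ 1`. -/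
noncomputable def gap (m n : ℕ) : ℝ :=
  arrangements m n *
    ((harmonic m : ℝ) - harmonic n + (1 / ((m : ℝ) + 1) - 1 / ((n : ℝ) + 1)) / 2)

/-- Two neighbouring four-point equations are subtracted. The recurrence closes up because `S (m+1)
(n+1)` is left with coefficient `m - n`, exactly the difference of `n + 2m + 4` and `m + 2n + 4`. -/
theorem scaledE_sub_rec (m n : ℕ) :
    ((m : ℝ) + n + 3) * (scaledE (m + 1) (n + 2) - scaledE (m + 2) (n + 1)) =
      (m + 2 * n + 4) * (scaledE m (n + 2) - scaledE (m + 1) (n + 1))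
      + (n + 2 * m + 4) * (scaledE (m + 1) (n + 1) - scaledE (m + 2) n)
      - 2 * (m + n + 1) * (scaledE m (n + 1) - scaledE (m + 1) n)
      + arrangements m (n + 1) - arrangements (m + 1) n := by
  have h1 := scaledE_succ_succ m (n + 1)
  have h2 := scaledE_succ_succ (m + 1) n
  simp only [source, Nat.add_eq_zero_iff, one_ne_zero, and_false, false_and, if_false,
    add_zero] at h1 h2
  push_cast at h1 h2
  linear_combination h1 - h2

theorem harmonic_succ_real (n : ℕ) : (harmonic (n + 1) : ℝ) = harmonic n + 1 / ((n : ℝ) + 1) := by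
  rw [harmonic_succ]
  push_cast
  ring

theorem gap_rec (m n : ℕ) :
    ((m : ℝ) + n + 3) * gap (m + 1) (n + 1) =
      (m + 2 * n + 4) * gap m (n + 1) + (n + 2 * m + 4) * gap (m + 1) n
      - 2 * (m + n + 1) * gap m n + arrangements m (n + 1) - arrangements (m + 1) n := by
  have hm1 : (m : ℝ) + 1 ≠ 0 := by positivity
  have hm2 : (m : ℝ) + 1 + 1 ≠ 0 := by positivity
  have hn1 : (n : ℝ) + 1 ≠ 0 := by positivity
  have hn2 : (n : ℝ) + 1 + 1 ≠ 0 := by positivity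
  simp only [gap, harmonic_succ_real, arrangements_succ_left, arrangements_succ_right]
  push_cast
  generalize arrangements m n = B
  generalize (harmonic m : ℝ) = x
  generalize (harmonic n : ℝ) = y
  field_simp
  ring

/-- On the edge the formula `gap` is off by `1 / (2 (n + 2))`. This defect is harmless: it cancels
from the recurrence for the first interior row. -/
theorem scaledE_sub_zero_left (n : ℕ) :
    scaledE 0 (n + 2) - scaledE 1 (n + 1) = gap 0 (n + 1) - 1 / (2 * ((n : ℝ) + 2)) := by
  have hn2 : (n : ℝ) + 2 ≠ 0 := by positivity
  have hn2' : (n : ℝ) + 1 + 1 ≠ 0 := by positivity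
  rw [scaledE_zero_left, scaledE_one_left, gap, arrangements_zero_left,
    harmonic_succ_real (n + 1), harmonic_zero]
  push_cast
  field_simp
  ring

theorem gap_comm (m n : ℕ) : gap n m = -gap m n := by
  rw [gap, gap, arrangements_comm]
  ring

theorem scaledE_sub_zero_right (m : ℕ) :
    scaledE (m + 1) 1 - scaledE (m + 2) 0 = gap (m + 1) 0 + 1 / (2 * ((m : ℝ) + 2)) := by
  have h := scaledE_sub_zero_left m
  rw [scaledE_comm (m + 1), scaledE_comm (m + 2), gap_comm 0]
  linarith

theorem scaledE_sub (m n : ℕ) :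
    scaledE (m + 1) (n + 2) - scaledE (m + 2) (n + 1) = gap (m + 1) (n + 1) := by
  induction m generalizing n with
  | zero =>
    induction n with
    -- Both sides vanish by symmetry.
    | zero => simp [gap, scaledE_comm 2 1]
    | succ n ih =>
      have hn2 : (n : ℝ) + 2 ≠ 0 := by positivity
      have hn3 : (n : ℝ) + 3 ≠ 0 := by positivity
      have h := scaledE_sub_rec 0 (n + 1)
      have hg := gap_rec 0 (n + 1)
      -- The two edge defects enter with coefficients `2 (n + 3)` and `-2 (n + 2)`, contributing
      -- `-1` and `+1`.
      rw [scaledE_sub_zero_left, scaledE_sub_zero_left, ih] at h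
      push_cast at h hg
      have hz : (0 + ((n : ℝ) + 1) + 3) ≠ 0 := by positivity
      apply mul_left_cancel₀ hz
      rw [h, hg]
      field_simp
      ring
  | succ m ihm =>
    have hm2 : (m : ℝ) + 2 ≠ 0 := by positivity
    have hm3 : (m : ℝ) + 3 ≠ 0 := by positivity
    induction n with
    | zero =>
      have h := scaledE_sub_rec (m + 1) 0
      have hg := gap_rec (m + 1) 0
      rw [scaledE_sub_zero_right, scaledE_sub_zero_right, ihm] at h
      push_cast at h hg
      have hz : ((m : ℝ) + 1 + 0 + 3) ≠ 0 := by positivity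
      apply mul_left_cancel₀ hz
      rw [h, hg]
      field_simp
      ring
    | succ n ihn =>
      have h := scaledE_sub_rec (m + 1) (n + 1)
      have hg := gap_rec (m + 1) (n + 1)
      rw [ihm, ihm, ihn] at h
      have hz : (((m + 1 : ℕ) : ℝ) + ((n + 1 : ℕ) : ℝ) + 3) ≠ 0 := by positivity
      exact mul_left_cancel₀ hz (h.trans hg.symm)

/-! ### Recurrences in one variable -/

/-- The second-order recurrence in `m`, whose inhomogeneous term involves harmonic numbers. -/
theorem E_second_order (m n : ℕ) :
    ((m : ℝ) + n + 4) * (m + n + 3) / ((m + 2) * (m + 3)) * E (m + 3) (n + 1)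
      - (3 * m + 3 * n + 10) / (m + 2) * E (m + 2) (n + 1) + 2 * E (m + 1) (n + 1) =
    (m + 2 * n + 5) * ((harmonic (m + 1) : ℝ) - harmonic (n + 1)
        + (1 / ((m : ℝ) + 2) - 1 / ((n : ℝ) + 2)) / 2)
      - (m + n + 4) * (m + n + 3) / (m + 2) * ((harmonic (m + 1) : ℝ) + 1 / ((m : ℝ) + 2)
        - harmonic (n + 1) + (1 / ((m : ℝ) + 3) - 1 / ((n : ℝ) + 2)) / 2) + 1 := by
  have hm2 : (m : ℝ) + 2 ≠ 0 := by positivity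
  have hm3 : (m : ℝ) + 3 ≠ 0 := by positivity
  have hn2 : (n : ℝ) + 2 ≠ 0 := by positivity
  have hmn2 : (m : ℝ) + n + 2 ≠ 0 := by positivity
  have hmn3 : (m : ℝ) + n + 3 ≠ 0 := by positivity
  have hmn4 : (m : ℝ) + n + 4 ≠ 0 := by positivity
  have hpos := (arrangements_pos (m + 1) (n + 1)).ne'
  have h := scaledE_succ_succ (m + 1) (n + 1)
  have h1 := scaledE_sub (m + 1) n
  have h0 := scaledE_sub m n
  rw [sub_eq_iff_eq_add] at h1 h0
  -- This removes the two values of `S` with second argument `n + 2`.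
  rw [h1, h0] at h
  simp only [source, Nat.add_eq_zero_iff, one_ne_zero, and_false, if_false, add_zero, gap, scaledE,
    arrangements_succ_left (m + 1) (n + 1), arrangements_succ_left (m + 2) (n + 1),
    harmonic_succ_real (m + 1)] at h
  apply mul_left_cancel₀ hpos
  generalize arrangements (m + 1) (n + 1) = B at *
  generalize (harmonic (m + 1) : ℝ) = x at *
  generalize (harmonic (n + 1) : ℝ) = y at *
  generalize E (m + 1) (n + 1) = e₁ at *
  generalize E (m + 2) (n + 1) = e₂ at *
  generalize E (m + 1 + 2) (n + 1) = e₃ at *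
  push_cast at h
  rw [show (m : ℝ) + 1 + 1 = m + 2 by ring, show (m : ℝ) + 1 + 2 = m + 3 by ring,
    show (m : ℝ) + 2 + 1 = m + 3 by ring, show (n : ℝ) + 1 + 1 = n + 2 by ring,
    show (m : ℝ) + 1 + (n + 1) = m + n + 2 by ring, show (m : ℝ) + 2 + (n + 1) = m + n + 3 by ring,
    show (m : ℝ) + 3 + (n + 1) = m + n + 4 by ring] at h
  linear_combination (norm := skip) h
  field_simp
  ring

/-- The fourth-order recurrence in `m`, which eliminates the harmonic numbers from
`E_second_order`. -/
theorem E_fourth_order (m n : ℕ) (hm : 0 < m) :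
      2 * ((m : ℝ) + 2) * ((m : ℝ) + 1) * (2 * (m : ℝ) * (n : ℝ) + 2 * (m : ℝ) + 7 * (n : ℝ) + 9) * (3 + (m : ℝ)) * E m n
        - (3 + (m : ℝ)) * ((m : ℝ) + 2) *
          (14 * (m : ℝ) ^ 2 * (n : ℝ) + 6 * (m : ℝ) * (n : ℝ) ^ 2 + 14 * (m : ℝ) ^ 2 + 83 * (m : ℝ) * (n : ℝ) + 21 * (n : ℝ) ^ 2
            + 91 * (m : ℝ) + 123 * (n : ℝ) + 128) * E (m + 1) n
        + (3 + (m : ℝ)) *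
          (18 * (m : ℝ) ^ 3 * (n : ℝ) + 16 * (m : ℝ) ^ 2 * (n : ℝ) ^ 2 + 2 * (m : ℝ) * (n : ℝ) ^ 3 + 18 * (m : ℝ) ^ 3
            + 167 * (m : ℝ) ^ 2 * (n : ℝ) + 94 * (m : ℝ) * (n : ℝ) ^ 2 + 7 * (n : ℝ) ^ 3 + 169 * (m : ℝ) ^ 2
            + 521 * (m : ℝ) * (n : ℝ) + 132 * (n : ℝ) ^ 2 + 511 * (m : ℝ) + 537 * (n : ℝ) + 508) * E (m + 2) n
        + (-10 * (m : ℝ) ^ 4 * (n : ℝ) - 14 * (m : ℝ) ^ 3 * (n : ℝ) ^ 2 - 4 * (m : ℝ) ^ 2 * (n : ℝ) ^ 3 - 10 * (m : ℝ) ^ 4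
            - 135 * (m : ℝ) ^ 3 * (n : ℝ) - 129 * (m : ℝ) ^ 2 * (n : ℝ) ^ 2 - 24 * (m : ℝ) * (n : ℝ) ^ 3 - 131 * (m : ℝ) ^ 3
            - 684 * (m : ℝ) ^ 2 * (n : ℝ) - 393 * (m : ℝ) * (n : ℝ) ^ 2 - 34 * (n : ℝ) ^ 3 - 639 * (m : ℝ) ^ 2
            - 1535 * (m : ℝ) * (n : ℝ) - 396 * (n : ℝ) ^ 2 - 1380 * (m : ℝ) - 1286 * (n : ℝ) - 1116) * E (m + 3) n
        + (3 + (m : ℝ)) * (2 * (m : ℝ) * (n : ℝ) + 2 * (m : ℝ) + 5 * (n : ℝ) + 7) * ((n : ℝ) + 4 + (m : ℝ)) * ((n : ℝ) + 3 + (m : ℝ)) *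
          E (m + 4) n = 0 := by
  obtain ⟨m, rfl⟩ := Nat.exists_eq_succ_of_ne_zero hm.ne'
  rcases n with _ | n
  · simp [E_zero_right]
  simp only [Nat.succ_eq_add_one]
  have q₀ := E_second_order m n
  have q₁ := E_second_order (m + 1) n
  have q₂ := E_second_order (m + 2) n
  rw [harmonic_succ_real (m + 2)] at q₂
  rw [show m + 1 + 1 = m + 2 by ring, show m + 1 + 2 = m + 3 by ring,
    show m + 1 + 3 = m + 4 by ring] at q₁ ⊢
  rw [show m + 2 + 1 = m + 3 by ring, show m + 2 + 2 = m + 4 by ring,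
    show m + 2 + 3 = m + 5 by ring] at q₂
  rw [show m + 1 + 4 = m + 5 by ring]
  rw [harmonic_succ_real (m + 1)] at q₁ q₂
  generalize (harmonic (m + 1) : ℝ) = h at *
  generalize (harmonic (n + 1) : ℝ) = k at *
  generalize E (m + 1) (n + 1) = e₀ at *
  generalize E (m + 2) (n + 1) = e₁ at *
  generalize E (m + 3) (n + 1) = e₂ at *
  generalize E (m + 4) (n + 1) = e₃ at *
  generalize E (m + 5) (n + 1) = e₄ at *
  have hx : (0 : ℝ) ≤ m := Nat.cast_nonneg m
  have hy : (0 : ℝ) ≤ n := Nat.cast_nonneg n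
  push_cast at q₁ q₂ ⊢
  generalize (m : ℝ) = x at *
  generalize (n : ℝ) = y at *
  rw [show x + 1 + 1 = x + 2 by ring, show x + 1 + 2 = x + 3 by ring,
    show x + 1 + 3 = x + 4 by ring] at q₁
  rw [show x + 1 + 1 = x + 2 by ring, show x + 2 + 1 = x + 3 by ring,
    show x + 2 + 2 = x + 4 by ring, show x + 2 + 3 = x + 5 by ring] at q₂
  have hx2 : x + 2 ≠ 0 := by positivity
  have hx3 : x + 3 ≠ 0 := by positivity
  have hx4 : x + 4 ≠ 0 := by positivity
  have hx5 : x + 5 ≠ 0 := by positivity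
  have hy2 : y + 2 ≠ 0 := by positivity
  -- With `m = x + 1` and `n = y + 1` in the goal, the multipliers of `q₀`, `q₁`, `q₂` are forced in
  -- turn by the coefficients of `e₀`, `e₁` and `e₄`. The terms in `e₂`, `e₃` and `h - k`, and the
  -- rational remainder, then agree identically.
  linear_combination (norm := skip)
    ((x + 2) * (x + 3) * (x + 4) * (2 * (x + 1) * (y + 1) + 2 * (x + 1) + 7 * (y + 1) + 9)) * q₀
    + ((x + 3) * (x + 4) / 2 *
        ((2 * (x + 1) * (y + 1) + 2 * (x + 1) + 7 * (y + 1) + 9) * (3 * x + 3 * y + 10)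
          - (14 * (x + 1) ^ 2 * (y + 1) + 6 * (x + 1) * (y + 1) ^ 2 + 14 * (x + 1) ^ 2
            + 83 * (x + 1) * (y + 1) + 21 * (y + 1) ^ 2 + 91 * (x + 1) + 123 * (y + 1) + 128))) * q₁
    + ((x + 4) ^ 2 * (x + 5) * (2 * (x + 1) * (y + 1) + 2 * (x + 1) + 5 * (y + 1) + 7)) * q₂
  field_simp
  ring

end UrnSolitaire

theorem theorem1 :
    (∀ m n : ℕ, MeasureTheory.Integrable (fun t : ℕ => (t : ℝ))
      (UrnSolitaire.rounds m n).toMeasure) ∧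
    (∀ m : ℕ, UrnSolitaire.E m 0 = 0) ∧
    (∀ n : ℕ, UrnSolitaire.E 0 n = 0) ∧
    (∀ m n : ℕ, 0 < m → 0 < n →
      UrnSolitaire.E m n = 1
        + ∑ k ∈ Finset.Icc 1 m, (m.choose k : ℝ) / ((m + n).choose k : ℝ)
            * ((n : ℝ) / ((m : ℝ) + n - k)) * UrnSolitaire.E (m - k) n
        + ∑ k ∈ Finset.Icc 1 n, (n.choose k : ℝ) / ((m + n).choose k : ℝ)
            * ((m : ℝ) / ((m : ℝ) + n - k)) * UrnSolitaire.E m (n - k)) ∧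
    (∀ m n : ℕ, 0 < m →
      2 * ((m : ℝ) + 2) * ((m : ℝ) + 1) * (2 * (m : ℝ) * (n : ℝ) + 2 * (m : ℝ) + 7 * (n : ℝ) + 9) * (3 + (m : ℝ)) * UrnSolitaire.E m n
        - (3 + (m : ℝ)) * ((m : ℝ) + 2) *
          (14 * (m : ℝ) ^ 2 * (n : ℝ) + 6 * (m : ℝ) * (n : ℝ) ^ 2 + 14 * (m : ℝ) ^ 2 + 83 * (m : ℝ) * (n : ℝ) + 21 * (n : ℝ) ^ 2
            + 91 * (m : ℝ) + 123 * (n : ℝ) + 128) * UrnSolitaire.E (m + 1) n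
        + (3 + (m : ℝ)) *
          (18 * (m : ℝ) ^ 3 * (n : ℝ) + 16 * (m : ℝ) ^ 2 * (n : ℝ) ^ 2 + 2 * (m : ℝ) * (n : ℝ) ^ 3 + 18 * (m : ℝ) ^ 3
            + 167 * (m : ℝ) ^ 2 * (n : ℝ) + 94 * (m : ℝ) * (n : ℝ) ^ 2 + 7 * (n : ℝ) ^ 3 + 169 * (m : ℝ) ^ 2
            + 521 * (m : ℝ) * (n : ℝ) + 132 * (n : ℝ) ^ 2 + 511 * (m : ℝ) + 537 * (n : ℝ) + 508) * UrnSolitaire.E (m + 2) n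
        + (-10 * (m : ℝ) ^ 4 * (n : ℝ) - 14 * (m : ℝ) ^ 3 * (n : ℝ) ^ 2 - 4 * (m : ℝ) ^ 2 * (n : ℝ) ^ 3 - 10 * (m : ℝ) ^ 4
            - 135 * (m : ℝ) ^ 3 * (n : ℝ) - 129 * (m : ℝ) ^ 2 * (n : ℝ) ^ 2 - 24 * (m : ℝ) * (n : ℝ) ^ 3 - 131 * (m : ℝ) ^ 3
            - 684 * (m : ℝ) ^ 2 * (n : ℝ) - 393 * (m : ℝ) * (n : ℝ) ^ 2 - 34 * (n : ℝ) ^ 3 - 639 * (m : ℝ) ^ 2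
            - 1535 * (m : ℝ) * (n : ℝ) - 396 * (n : ℝ) ^ 2 - 1380 * (m : ℝ) - 1286 * (n : ℝ) - 1116) * UrnSolitaire.E (m + 3) n
        + (3 + (m : ℝ)) * (2 * (m : ℝ) * (n : ℝ) + 2 * (m : ℝ) + 5 * (n : ℝ) + 7) * ((n : ℝ) + 4 + (m : ℝ)) * ((n : ℝ) + 3 + (m : ℝ)) *
          UrnSolitaire.E (m + 4) n = 0) ∧
    (∀ m n : ℕ, 0 < n →
      2 * ((n : ℝ) + 2) * ((n : ℝ) + 1) * (2 * (n : ℝ) * (m : ℝ) + 2 * (n : ℝ) + 7 * (m : ℝ) + 9) * (3 + (n : ℝ)) * UrnSolitaire.E m n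
        - (3 + (n : ℝ)) * ((n : ℝ) + 2) *
          (14 * (n : ℝ) ^ 2 * (m : ℝ) + 6 * (n : ℝ) * (m : ℝ) ^ 2 + 14 * (n : ℝ) ^ 2 + 83 * (n : ℝ) * (m : ℝ) + 21 * (m : ℝ) ^ 2
            + 91 * (n : ℝ) + 123 * (m : ℝ) + 128) * UrnSolitaire.E m (n + 1)
        + (3 + (n : ℝ)) *
          (18 * (n : ℝ) ^ 3 * (m : ℝ) + 16 * (n : ℝ) ^ 2 * (m : ℝ) ^ 2 + 2 * (n : ℝ) * (m : ℝ) ^ 3 + 18 * (n : ℝ) ^ 3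
            + 167 * (n : ℝ) ^ 2 * (m : ℝ) + 94 * (n : ℝ) * (m : ℝ) ^ 2 + 7 * (m : ℝ) ^ 3 + 169 * (n : ℝ) ^ 2
            + 521 * (n : ℝ) * (m : ℝ) + 132 * (m : ℝ) ^ 2 + 511 * (n : ℝ) + 537 * (m : ℝ) + 508) * UrnSolitaire.E m (n + 2)
        + (-10 * (n : ℝ) ^ 4 * (m : ℝ) - 14 * (n : ℝ) ^ 3 * (m : ℝ) ^ 2 - 4 * (n : ℝ) ^ 2 * (m : ℝ) ^ 3 - 10 * (n : ℝ) ^ 4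
            - 135 * (n : ℝ) ^ 3 * (m : ℝ) - 129 * (n : ℝ) ^ 2 * (m : ℝ) ^ 2 - 24 * (n : ℝ) * (m : ℝ) ^ 3 - 131 * (n : ℝ) ^ 3
            - 684 * (n : ℝ) ^ 2 * (m : ℝ) - 393 * (n : ℝ) * (m : ℝ) ^ 2 - 34 * (m : ℝ) ^ 3 - 639 * (n : ℝ) ^ 2
            - 1535 * (n : ℝ) * (m : ℝ) - 396 * (m : ℝ) ^ 2 - 1380 * (n : ℝ) - 1286 * (m : ℝ) - 1116) * UrnSolitaire.E m (n + 3)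
        + (3 + (n : ℝ)) * (2 * (n : ℝ) * (m : ℝ) + 2 * (n : ℝ) + 5 * (m : ℝ) + 7) * ((m : ℝ) + 4 + (n : ℝ)) * ((m : ℝ) + 3 + (n : ℝ)) *
          UrnSolitaire.E m (n + 4) = 0) := by
  exact ⟨UrnSolitaire.integrable_rounds, UrnSolitaire.E_zero_right, UrnSolitaire.E_zero_left,
    UrnSolitaire.E_eq, UrnSolitaire.E_fourth_order, fun m n hn => by
      simpa only [UrnSolitaire.E_comm] using UrnSolitaire.E_fourth_order n m hn⟩
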